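/- Let $d\in\{2,3\}$ and $l\ge 0$. Let $T\subset\mathbb R^d$ be a nonempty open polyhedral mesh element with diameter $h_T$, and let $\mathfrak T_T$ be a finite matching simplicial submesh of $T$: the closed (nondegenerate) simplices cover $\overline T$, their interiors lie in $T$, any two closed simplices meet in the (possibly empty) face spanned by their common vertices, and all of them share a vertex $\boldsymbol x_T$. Let $\mathcal P^m(T)$ be the polynomials of total degree $\le m$ on $T$, $\mathcal P^m(\mathfrak T_T)$ the broken polynomials of total degree $\le m$ on $\mathfrak T_T$, and $\nabla$ the piecewise gradient. Set $\mathcal G^l(\mathfrak T_T)=\nabla\mathcal P^{l+1}(\mathfrak T_T)$; $\mathcal G^{{\rm c},0}(\mathfrak T_T)=\{\boldsymbol 0\}$ and, for $l\ge1$, $\mathcal G^{{\rm c},l}(\mathfrak T_T)=\{\alpha\,(-(x_2-x_{T,2}),\,x_1-x_{T,1}):\alpha\in\mathcal P^{l-1}(\mathfrak T_T)\}$ if $d=2$ and $\mathcal G^{{\rm c},l}(\mathfrak T_T)=(\boldsymbol x-\boldsymbol x_T)\times\mathcal P^{l-1}(\mathfrak T_T)^3$ if $d=3$. Let $\pi_{\mathcal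 G}$ and $\pi_{\mathcal G}^{\rm c}$ be the $L^2(T)^d$-orthogonal projectors of $\mathcal P^l(\mathfrak T_T)^d$ onto $\mathcal G^l(\mathfrak T_T)$ and $\mathcal G^{{\rm c},l}(\mathfrak T_T)$. Then $\mathrm{Id}-\pi_{\mathcal G}\pi_{\mathcal G}^{\rm c}$ is invertible on $\mathcal P^l(\mathfrak T_T)^d$, and for every $\boldsymbol q\in\mathcal P^l(\mathfrak T_T)^d$ there is exactly one $\varrho\boldsymbol q=\varrho^{l+1}_{\mathfrak T_T}\boldsymbol q\in\mathcal P^{l+1}(\mathfrak T_T)$ such that $$\nabla\varrho\boldsymbol q=(\mathrm{Id}-\pi_{\mathcal G}\pi_{\mathcal G}^{\rm c})^{-1}\big(\pi_{\mathcal G}\boldsymbol q-\pi_{\mathcal G}\pi_{\mathcal G}^{\rm c}\boldsymbol q\big)\quad\text{and}\quad(\varrho\boldsymbol q)_{|\tau}(\boldsymbol x_T)=0\ \text{ for all }\tau\in\mathfrak T_T.$$ The operator $\varrho:\mathcal P^l(\mathfrak T_T)^d\to\mathcal P^{l+1}(\mathfrak T_T)$ is linear and has the following properties. (i) $\nabla\varrho\boldsymbol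 b=\boldsymbol b$ for all $\boldsymbol b\in\mathcal G^l(\mathfrak T_T)$, and $\varrho\boldsymbol c=0$ for all $\boldsymbol c\in\mathcal G^{{\rm c},l}(\mathfrak T_T)$. (ii) For every $\rho\in(0,1)$ there is a constant $C>0$, depending only on $d$, $l$ and $\rho$, such that, whenever the submesh is regular with parameter $\rho$ (that is, $\rho h_\tau\le r_\tau$ and $\rho h_T\le h_\tau$ for all $\tau\in\mathfrak T_T$, where $h_\tau$ is the diameter and $r_\tau$ the inradius of $\tau$), $$\|\varrho\boldsymbol q\|_{L^2(T)}+h_T\|\nabla\varrho\boldsymbol q\|_{L^2(T)^d}\le C\,h_T\|\boldsymbol q\|_{L^2(T)^d}\qquad\text{for all }\boldsymbol q\in\mathcal P^l(\mathfrak T_T)^d.$$ (iii) $(\mathrm{Id}-\nabla\varrho)\boldsymbol q\in\mathcal G^{{\rm c},l}(\mathfrak T_T)$ for all $\boldsymbol q\in\mathcal P^l(\mathfrak T_T)^d$. (iv) $\varrho\boldsymbol q\in\mathcal P^{l+1}(T)$ for all $\boldsymbol q\in\mathcal P^l(T)^d$. -/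

import Mathlib

open MeasureTheory

noncomputable section

namespace HHO

/-! ### Polynomials

A polynomial function on a set with nonempty interior is identified with the (unique) formal
polynomial that induces it. -/

/-- Scalar polynomials in `d` space variables of total degree at most `l`. -/
abbrev Poly (d l : ℕ) : Submodule ℝ (MvPolynomial (Fin d) ℝ) :=
  MvPolynomial.restrictTotalDegree (Fin d) ℝ l

/-- Vector-valued polynomials (`d` components in `d` variables) of total degree at most `l`. -/
abbrev PolyVec (d l : ℕ) : Submodule ℝ (Fin d → MvPolynomial (Fin d) ℝ) :=
  Submodule.pi Set.univ fun _ => Poly d l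

/-- The value of a vector-valued polynomial at a point. -/
def evalVec {d : ℕ} (q : Fin d → MvPolynomial (Fin d) ℝ) (x : EuclideanSpace ℝ (Fin d)) :
    EuclideanSpace ℝ (Fin d) :=
  WithLp.toLp 2 fun i => MvPolynomial.eval x.ofLp (q i)

theorem pderiv_mem_poly {d l : ℕ} (i : Fin d) {p : MvPolynomial (Fin d) ℝ}
    (hp : p ∈ Poly d (l + 1)) : MvPolynomial.pderiv i p ∈ Poly d l := by
  classical
  rw [MvPolynomial.mem_restrictTotalDegree] at hp
  rw [MvPolynomial.as_sum p, map_sum]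
  refine Submodule.sum_mem _ fun s hs => ?_
  rw [MvPolynomial.pderiv_monomial, MvPolynomial.mem_restrictTotalDegree]
  by_cases hsi : s i = 0
  · simp [hsi]
  refine (MvPolynomial.totalDegree_monomial_le _ _).trans ?_
  have h1 : (s.sum fun _ e => e) ≤ l + 1 := (MvPolynomial.le_totalDegree hs).trans hp
  have hle : Finsupp.single i 1 ≤ s := by
    rw [Finsupp.single_le_iff]; omega
  have h2 : s = (s - Finsupp.single i 1) + Finsupp.single i 1 := (tsub_add_cancel_of_le hle).symm
  have h3 : (s.sum fun _ e => e) =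
      ((s - Finsupp.single i 1).sum fun _ e => e) + 1 := by
    conv_lhs => rw [h2]
    rw [Finsupp.sum_add_index' (fun _ => rfl) (fun _ _ _ => rfl), Finsupp.sum_single_index rfl]
  change ((s - Finsupp.single i 1).sum fun _ e => e) ≤ l
  rw [h3] at h1
  exact Nat.le_of_succ_le_succ h1

/-- The gradient `Poly (l + 1) → PolyVec l`. -/
def gradPoly (d l : ℕ) : Poly d (l + 1) →ₗ[ℝ] PolyVec d l :=
  LinearMap.codRestrict _
    (LinearMap.pi fun i => (MvPolynomial.pderiv i).toLinearMap ∘ₗ (Poly d (l + 1)).subtype)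
    fun p => by
      rw [Submodule.mem_pi]
      exact fun i _ => pderiv_mem_poly i p.2

/-- The polynomial vector field `x ↦ x - x₀`. -/
def shiftedPosition {d : ℕ} (x₀ : EuclideanSpace ℝ (Fin d)) : Fin d → MvPolynomial (Fin d) ℝ :=
  fun i => MvPolynomial.X i - MvPolynomial.C (x₀ i)

/-- The Koszul complement of degree `l` centred at `x₀`:
`(x - x₀)^⊥ P^{l-1}`, with `y^⊥ = (-y₂, y₁)`, when `d = 2`, and `(x - x₀) × (P^{l-1})³` when
`d = 3`, for `l ≥ 1`; it is `{0}` for `l = 0`.  Other dimensions are not used. -/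
def koszulPoly : (d : ℕ) → EuclideanSpace ℝ (Fin d) → ℕ →
    Submodule ℝ (Fin d → MvPolynomial (Fin d) ℝ)
  | 2, x₀, m + 1 =>
      (Poly 2 m).map (LinearMap.pi ![
        LinearMap.mulLeft ℝ (-(shiftedPosition x₀ 1)),
        LinearMap.mulLeft ℝ (shiftedPosition x₀ 0)])
  | 3, x₀, m + 1 =>
      (PolyVec 3 m).map ((crossProduct (shiftedPosition x₀)).restrictScalars ℝ)
  | _, _, _ => ⊥

/-! ### Mesh elements and their simplicial submeshes -/

/-- The inradius of a set: the supremum of the radii of the balls that it contains. -/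
def inradius {d : ℕ} (s : Set (EuclideanSpace ℝ (Fin d))) : ℝ :=
  sSup {r : ℝ | 0 ≤ r ∧ ∃ c, Metric.closedBall c r ⊆ s}

/-- A mesh element `T` together with its matching simplicial submesh, all of whose simplices share
the vertex `xT`.  A simplex is given by its finite set of vertices; the corresponding closed
simplex is the convex hull, and the open simplex its interior. -/
structure MeshElement (d : ℕ) where
  /-- the element, as an open set -/
  T : Set (EuclideanSpace ℝ (Fin d))
  isOpen_T : IsOpen T
  nonempty_T : T.Nonempty
  /-- the simplices of the submesh -/
  simplices : Finset (Finset (EuclideanSpace ℝ (Fin d)))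
  card_vertices : ∀ τ ∈ simplices, τ.card = d + 1
  affineIndependent : ∀ τ ∈ simplices,
    AffineIndependent ℝ ((↑) : τ → EuclideanSpace ℝ (Fin d))
  /-- two closed simplices meet along the (possibly empty) face spanned by common vertices -/
  matching : ∀ τ ∈ simplices, ∀ τ' ∈ simplices,
    convexHull ℝ (τ : Set (EuclideanSpace ℝ (Fin d))) ∩ convexHull ℝ (τ' : Set _) =
      convexHull ℝ ((τ : Set (EuclideanSpace ℝ (Fin d))) ∩ (τ' : Set _))
  /-- the open simplices lie in the element -/
  interior_subset : ∀ τ ∈ simplices,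
    interior (convexHull ℝ (τ : Set (EuclideanSpace ℝ (Fin d)))) ⊆ T
  /-- the closed simplices cover the closed element -/
  closure_eq : closure T =
    ⋃ τ ∈ simplices, convexHull ℝ (τ : Set (EuclideanSpace ℝ (Fin d)))
  /-- the common vertex -/
  xT : EuclideanSpace ℝ (Fin d)
  xT_mem : ∀ τ ∈ simplices, xT ∈ τ

namespace MeshElement

variable {d : ℕ} (M : MeshElement d)

/-- The diameter `h_T` of the element. -/
def diam : ℝ := Metric.diam M.T

/-- The open simplex with index `τ`. -/
def openSimplex (τ : M.simplices) : Set (EuclideanSpace ℝ (Fin d)) :=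
  interior (convexHull ℝ (τ.1 : Set (EuclideanSpace ℝ (Fin d))))

/-- Mesh regularity with parameter `ρ`, for one element and its submesh. -/
structure IsRegular (ρ : ℝ) : Prop where
  /-- shape regularity: `ρ h_τ ≤ r_τ` -/
  shape : ∀ τ ∈ M.simplices,
    ρ * Metric.diam (convexHull ℝ (τ : Set (EuclideanSpace ℝ (Fin d)))) ≤
      inradius (convexHull ℝ (τ : Set (EuclideanSpace ℝ (Fin d))))
  /-- contact regularity: `ρ h_T ≤ h_τ` -/
  contact : ∀ τ ∈ M.simplices,
    ρ * M.diam ≤ Metric.diam (convexHull ℝ (τ : Set (EuclideanSpace ℝ (Fin d))))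

theorem isOpen_openSimplex (τ : M.simplices) : IsOpen (M.openSimplex τ) := isOpen_interior

theorem openSimplex_subset (τ : M.simplices) : M.openSimplex τ ⊆ M.T :=
  M.interior_subset τ.1 τ.2

theorem isBounded_T : Bornology.IsBounded M.T := by
  refine Bornology.IsBounded.subset ?_ subset_closure
  rw [M.closure_eq]
  refine (Bornology.isBounded_biUnion_finset M.simplices).2 ?_
  intro τ _
  exact isBounded_convexHull.2 τ.finite_toSet.isBounded

theorem openSimplex_nonempty (τ : M.simplices) : (M.openSimplex τ).Nonempty := by
  unfold openSimplex
  rw [interior_convexHull_nonempty_iff_affineSpan_eq_top]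
  have h := (M.affineIndependent τ.1 τ.2).affineSpan_eq_top_iff_card_eq_finrank_add_one
  rw [Subtype.range_coe_subtype, Finset.setOfPred_mem] at h
  rw [h]
  simp [M.card_vertices τ.1 τ.2]

theorem disjoint_openSimplex {τ τ' : M.simplices} (h : τ ≠ τ') :
    Disjoint (M.openSimplex τ) (M.openSimplex τ') := by
  classical
  rw [Set.disjoint_iff_inter_eq_empty, openSimplex, openSimplex, ← interior_inter,
    M.matching τ.1 τ.2 τ'.1 τ'.2, ← Finset.coe_inter]
  by_contra hne
  rw [← Ne, ← Set.nonempty_iff_ne_empty, interior_convexHull_nonempty_iff_affineSpan_eq_top] at hne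
  have hind : AffineIndependent ℝ
      ((↑) : (τ.1 ∩ τ'.1 : Finset _) → EuclideanSpace ℝ (Fin d)) :=
    (M.affineIndependent τ.1 τ.2).mono (s := ((τ.1 ∩ τ'.1 : Finset _) : Set _))
      (by exact_mod_cast Finset.inter_subset_left)
  have hc := hind.affineSpan_eq_top_iff_card_eq_finrank_add_one
  rw [Subtype.range_coe_subtype, Finset.setOfPred_mem] at hc
  have hcard := hc.1 hne
  simp only [Fintype.card_coe, finrank_euclideanSpace, Fintype.card_fin] at hcard
  have e1 : τ.1 ∩ τ'.1 = τ.1 := Finset.eq_of_subset_of_card_le Finset.inter_subset_left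
    (by rw [hcard, M.card_vertices τ.1 τ.2])
  have e2 : τ.1 ∩ τ'.1 = τ'.1 := Finset.eq_of_subset_of_card_le Finset.inter_subset_right
    (by rw [hcard, M.card_vertices τ'.1 τ'.2])
  exact h (Subtype.ext (e1.symm.trans e2))

/-! ### Broken polynomials on the submesh -/

/-- Scalar broken polynomials `P^l(𝔗_T)`: one polynomial for each simplex. -/
abbrev BrokenPoly (l : ℕ) : Type := M.simplices → Poly d l

/-- Vector-valued broken polynomials `P^l(𝔗_T)^d`: one polynomial field for each simplex. -/
def BrokenVec (l : ℕ) : Type := M.simplices → PolyVec d l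

instance (l : ℕ) : AddCommGroup (M.BrokenVec l) :=
  inferInstanceAs (AddCommGroup (M.simplices → PolyVec d l))

instance (l : ℕ) : Module ℝ (M.BrokenVec l) :=
  inferInstanceAs (Module ℝ (M.simplices → PolyVec d l))

instance instFiniteDimensionalPoly (d l : ℕ) : FiniteDimensional ℝ (Poly d l) := by
  have hfin : {n : Fin d →₀ ℕ | n.degree ≤ l}.Finite := by
    refine Set.Finite.subset (Set.finite_Iic (Finsupp.equivFunOnFinite.symm fun _ => l)) ?_
    intro n hn i
    exact (Finsupp.le_degree i n).trans hn
  have : Finite {n : Fin d →₀ ℕ | n.degree ≤ l} := hfin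
  exact Module.Finite.of_basis (MvPolynomial.basisRestrictSupport ℝ {n : Fin d →₀ ℕ | n.degree ≤ l})

instance (l : ℕ) : FiniteDimensional ℝ (M.BrokenVec l) := by
  have : FiniteDimensional ℝ (PolyVec d l) := by
    refine FiniteDimensional.of_injective
      (LinearMap.pi fun i => LinearMap.codRestrict (Poly d l)
        (LinearMap.proj i ∘ₗ (PolyVec d l).subtype)
        (fun q => (Submodule.mem_pi.1 q.2) i trivial)) ?_
    intro p q h
    ext1
    funext i
    exact congrArg Subtype.val (congrFun h i)
  exact inferInstanceAs (FiniteDimensional ℝ (M.simplices → PolyVec d l))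

variable {M}

/-- The polynomial field attached to the simplex `τ`. -/
def BrokenVec.on {l : ℕ} (q : M.BrokenVec l) (τ : M.simplices) : PolyVec d l := q τ

/-- The function on `T` defined by a scalar broken polynomial: it equals the polynomial attached
to `τ` on the open simplex `τ`, and `0` on the remaining null set. -/
def BrokenPoly.toFun {l : ℕ} (p : M.BrokenPoly l) (x : EuclideanSpace ℝ (Fin d)) : ℝ :=
  ∑ τ, (M.openSimplex τ).indicator
    (fun y => MvPolynomial.eval y.ofLp (p τ : MvPolynomial (Fin d) ℝ)) x

/-- The function on `T` defined by a vector-valued broken polynomial. -/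
def BrokenVec.toFun {l : ℕ} (q : M.BrokenVec l) (x : EuclideanSpace ℝ (Fin d)) :
    EuclideanSpace ℝ (Fin d) :=
  ∑ τ, (M.openSimplex τ).indicator (evalVec (q.on τ).1) x

variable (M)

/-- The norm of `L²(T)`. -/
def l2norm {F : Type*} [NormedAddCommGroup F] (f : EuclideanSpace ℝ (Fin d) → F) : ℝ :=
  Real.sqrt (∫ x in M.T, ‖f x‖ ^ 2)

/-- The piecewise gradient `P^{l+1}(𝔗_T) → P^l(𝔗_T)^d`. -/
def grad (l : ℕ) : M.BrokenPoly (l + 1) →ₗ[ℝ] M.BrokenVec l where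
  toFun p := fun τ => gradPoly d l (p τ)
  map_add' p q := funext fun τ => map_add (gradPoly d l) (p τ) (q τ)
  map_smul' c p := funext fun τ => map_smul (gradPoly d l) c (p τ)

/-- The space `𝒢^l(𝔗_T) = ∇ P^{l+1}(𝔗_T)`. -/
def goly (l : ℕ) : Submodule ℝ (M.BrokenVec l) := LinearMap.range (M.grad l)

/-- The Koszul complement `𝒢^{c,l}(𝔗_T)`, centred at the common vertex. -/
def golyC (l : ℕ) : Submodule ℝ (M.BrokenVec l) where
  carrier := {q : M.BrokenVec l | ∀ τ, (q.on τ).1 ∈ koszulPoly d M.xT l}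
  add_mem' {_ _} hp hq τ := Submodule.add_mem _ (hp τ) (hq τ)
  zero_mem' _ := Submodule.zero_mem _
  smul_mem' c _ hq τ := Submodule.smul_mem _ c (hq τ)

/-- The inclusion of `P^l(T)` in `P^l(𝔗_T)`. -/
def ofPoly {l : ℕ} (p : Poly d l) : M.BrokenPoly l := fun _ => p

/-- The inclusion of `P^l(T)^d` in `P^l(𝔗_T)^d`. -/
def ofPolyVec {l : ℕ} (q : PolyVec d l) : M.BrokenVec l := fun _ => q

/-! ### The `L²(T)` inner product on vector-valued broken polynomials -/

theorem continuous_evalVec (q : Fin d → MvPolynomial (Fin d) ℝ) : Continuous (evalVec q) := by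
  unfold evalVec
  refine (PiLp.continuous_toLp 2 _).comp (continuous_pi fun i => ?_)
  exact (MvPolynomial.continuous_eval (q i)).comp (PiLp.continuous_ofLp 2 _)

variable {M}

theorem BrokenVec.toFun_of_mem {l : ℕ} (q : M.BrokenVec l) {τ : M.simplices}
    {x : EuclideanSpace ℝ (Fin d)} (hx : x ∈ M.openSimplex τ) : q.toFun x = evalVec (q.on τ).1 x := by
  rw [BrokenVec.toFun, Finset.sum_eq_single τ]
  · exact Set.indicator_of_mem hx _
  · intro τ' _ hne
    exact Set.indicator_of_notMem
      (fun hx' => Set.disjoint_left.1 (M.disjoint_openSimplex hne) hx' hx) _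
  · simp

theorem BrokenVec.toFun_add {l : ℕ} (p q : M.BrokenVec l) (x : EuclideanSpace ℝ (Fin d)) :
    (p + q).toFun x = p.toFun x + q.toFun x := by
  simp only [BrokenVec.toFun, ← Finset.sum_add_distrib]
  refine Finset.sum_congr rfl fun τ _ => ?_
  have h : evalVec ((p + q).on τ).1 = evalVec (p.on τ).1 + evalVec (q.on τ).1 := by
    ext y i
    exact map_add _ _ _
  rw [h, Set.indicator_add', Pi.add_apply]

theorem BrokenVec.toFun_smul {l : ℕ} (c : ℝ) (q : M.BrokenVec l) (x : EuclideanSpace ℝ (Fin d)) :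
    (c • q).toFun x = c • q.toFun x := by
  simp only [BrokenVec.toFun, Finset.smul_sum]
  refine Finset.sum_congr rfl fun τ _ => ?_
  have h : evalVec ((c • q).on τ).1 = c • evalVec (q.on τ).1 := by
    ext y i
    exact MvPolynomial.smul_eval _ _ _
  rw [h]
  exact Set.indicator_const_smul_apply _ c _ x

theorem BrokenVec.memLp {l : ℕ} (q : M.BrokenVec l) :
    MemLp q.toFun 2 (volume.restrict M.T) := by
  have : q.toFun = ∑ τ, (M.openSimplex τ).indicator (evalVec (q.on τ).1) := by
    ext x : 1
    rw [Finset.sum_apply, BrokenVec.toFun]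
  rw [this]
  refine memLp_finsetSum' _ fun τ _ => ?_
  refine MemLp.indicator (M.isOpen_openSimplex τ).measurableSet ?_
  have hK : IsCompact (closure M.T) := M.isBounded_T.isCompact_closure
  have : MemLp (evalVec (q.on τ).1) 2 (volume.restrict (closure M.T)) := by
    obtain ⟨C, hC⟩ := hK.exists_bound_of_continuousOn (continuous_evalVec (q.on τ).1).continuousOn
    have : IsFiniteMeasure (volume.restrict (closure M.T)) :=
      ⟨by simpa using hK.measure_lt_top⟩
    refine MemLp.of_bound (continuous_evalVec (q.on τ).1).aestronglyMeasurable C ?_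
    exact (ae_restrict_iff' isClosed_closure.measurableSet).2 (Filter.Eventually.of_forall hC)
  exact this.mono_measure (Measure.restrict_mono subset_closure le_rfl)

theorem BrokenVec.integrable_inner {l : ℕ} (p q : M.BrokenVec l) :
    Integrable (fun x => inner ℝ (p.toFun x) (q.toFun x)) (volume.restrict M.T) := by
  have h := L2.integrable_inner (𝕜 := ℝ) p.memLp.toLp q.memLp.toLp
  refine h.congr ?_
  filter_upwards [p.memLp.coeFn_toLp, q.memLp.coeFn_toLp] with x hp hq
  rw [hp, hq]

theorem polynomial_eq_zero_of_open {p : MvPolynomial (Fin d) ℝ}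
    {U : Set (EuclideanSpace ℝ (Fin d))} (hU : IsOpen U) (hne : U.Nonempty)
    (h : ∀ x ∈ U, MvPolynomial.eval x.ofLp p = 0) : p = 0 := by
  obtain ⟨x, hx⟩ := hne
  have hV : IsOpen ((WithLp.toLp 2 : (Fin d → ℝ) → EuclideanSpace ℝ (Fin d)) ⁻¹' U) :=
    hU.preimage (PiLp.continuous_toLp 2 _)
  obtain ⟨ε, hε, hb⟩ := Metric.isOpen_iff.1 hV x.ofLp (by simpa using hx)
  refine MvPolynomial.funext_set (fun i => Metric.ball (x.ofLp i) ε) (fun i => ?_) fun y hy => ?_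
  · rw [Real.ball_eq_Ioo]
    exact Set.Ioo_infinite (by linarith)
  · rw [← ball_pi _ hε] at hy
    simpa using h _ (hb hy)

/-- The `L²(T)` inner product `∫_T p · q`. -/
instance instCore (l : ℕ) : InnerProductSpace.Core ℝ (M.BrokenVec l) where
  inner p q := ∫ x in M.T, inner ℝ (p.toFun x) (q.toFun x)
  conj_inner_symm p q := by
    simp only [conj_trivial]
    exact integral_congr_ae (Filter.Eventually.of_forall fun x => real_inner_comm _ _)
  re_inner_nonneg p := by
    simp only [RCLike.re_to_real]
    exact integral_nonneg fun x => real_inner_self_nonneg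
  add_left p q r := by
    rw [← integral_add (p.integrable_inner r) (q.integrable_inner r)]
    simp only [BrokenVec.toFun_add, inner_add_left]
  smul_left p q c := by
    simp only [BrokenVec.toFun_smul, inner_smul_left, integral_const_mul]
  definite p hp := by
    have h0 := (integral_eq_zero_iff_of_nonneg (fun x => real_inner_self_nonneg)
      (p.integrable_inner p)).1 hp
    funext τ
    ext1
    funext i
    refine polynomial_eq_zero_of_open (M.isOpen_openSimplex τ) (M.openSimplex_nonempty τ) ?_
    have h1 : evalVec (p.on τ).1 =ᵐ[volume.restrict (M.openSimplex τ)] fun _ => 0 := by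
      have h2 := ae_restrict_of_ae_restrict_of_subset (M.openSimplex_subset τ) h0
      filter_upwards [h2, ae_restrict_mem (M.isOpen_openSimplex τ).measurableSet] with x hx hm
      rw [← p.toFun_of_mem hm]
      exact inner_self_eq_zero.1 hx
    have h3 := Measure.eqOn_open_of_ae_eq h1 (M.isOpen_openSimplex τ)
      (continuous_evalVec _).continuousOn continuousOn_const
    intro x hx
    have := congrArg (fun v : EuclideanSpace ℝ (Fin d) => v i) (h3 hx)
    simpa [evalVec, BrokenVec.on] using this

instance (l : ℕ) : NormedAddCommGroup (M.BrokenVec l) :=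
  (instCore l).toNormedAddCommGroup

instance (l : ℕ) : InnerProductSpace ℝ (M.BrokenVec l) :=
  InnerProductSpace.ofCore (instCore l).toCore

instance (l : ℕ) : CompleteSpace (M.BrokenVec l) := FiniteDimensional.complete ℝ _

instance (l : ℕ) (S : Submodule ℝ (M.BrokenVec l)) : S.HasOrthogonalProjection :=
  have : CompleteSpace S := FiniteDimensional.complete ℝ S
  inferInstance

theorem inner_eq_integral {l : ℕ} (p q : M.BrokenVec l) :
    inner ℝ p q = ∫ x in M.T, inner ℝ (p.toFun x) (q.toFun x) := rfl

variable (M)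

/-! ### The scalar potential operator -/

/-- The `L²`-orthogonal projector onto `𝒢^l(𝔗_T)`. -/
def projG (l : ℕ) : M.BrokenVec l →L[ℝ] M.BrokenVec l := (M.goly l).starProjection

/-- The `L²`-orthogonal projector onto `𝒢^{c,l}(𝔗_T)`. -/
def projGC (l : ℕ) : M.BrokenVec l →L[ℝ] M.BrokenVec l := (M.golyC l).starProjection

/-- The two conditions that define the potential `r = ϱ^{l+1} q`: its piecewise gradient is
`(Id - π_G π_Gc)⁻¹ (π_G q - π_G π_Gc q)`, and it vanishes at the common vertex in each simplex. -/
def IsPotential (l : ℕ) (q : M.BrokenVec l) (r : M.BrokenPoly (l + 1)) : Prop :=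
  M.grad l r = Ring.inverse (1 - M.projG l * M.projGC l)
      (M.projG l q - M.projG l (M.projGC l q)) ∧
    ∀ τ, MvPolynomial.eval M.xT.ofLp (r τ : MvPolynomial (Fin d) ℝ) = 0

/-- The scalar potential operator `ϱ^{l+1} : P^l(𝔗_T)^d → P^{l+1}(𝔗_T)`. -/
def potOp (l : ℕ) (q : M.BrokenVec l) : M.BrokenPoly (l + 1) :=
  Classical.epsilon (M.IsPotential l q)

end MeshElement

end HHO

end

noncomputable section

namespace HHO

/-! ### Chain rule, the Euler operator and the Koszul decomposition -/

/-! Everything follows from one identity: Koszul fields are pointwise orthogonal to `x - x_T`. If `q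
- ∇r` is a Koszul field on a simplex, then `(x - x_T) · ∇r = (x - x_T) · q`. The kernel of the Euler
operator `E = (x - x_T) · ∇` consists of the constants, so this equation and `r(x_T) = 0` determine
`r`. For existence, `E + 1` is bijective on polynomials of degree at most `l`; with `(E + 1) w_i =
q_i` and `r = (x - x_T) · w`, the difference `q - ∇r` is `(∇wᵀ - ∇w)`-type, that is `x - x_T`
contracted with the antisymmetric part of the derivative of `w`, which is a Koszul field
(`exists_potential`). Hence gradients and Koszul fields are algebraic complements.

For two complementary subspaces, `Id - π_G π_Gc` is invertible and the defining formula is the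
oblique projection onto gradients along Koszul fields. This is `isPotential_iff`: a potential is
characterised by `q - ∇r` being Koszul and by its vanishing at `x_T`. Linearity and (i), (iii), (iv)
can be read off; for (iv), the simplices share `x_T`, so one global polynomial serves on all of
them.

For (ii), only the Euler relation and `r(x_T) = 0` are retained. The pairs `(q, r)` satisfying them
form a finite-dimensional space on which `q` determines `r`, so `r` and `∇r` on the unit ball are
controlled by `q` on any small ball. A compactness argument makes the constant independent of the
small ball's centre, and scaling transfers the bound to a simplex, which lies in the ball of radius
`h_τ` about `x_T` and contains a ball of radius `ρ h_τ / 2`. No reference simplex is needed, and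
adding squares over simplices keeps the constant independent of their number. -/

/-- Chain rule for a derivation applied to a polynomial substitution. -/
theorem derivation_aeval {d : ℕ} {A : Type*} [CommRing A] [Algebra ℝ A] (D : Derivation ℝ A A)
    (f : Fin d → A) (p : MvPolynomial (Fin d) ℝ) :
    D (MvPolynomial.aeval f p) =
      ∑ i, MvPolynomial.aeval f (MvPolynomial.pderiv i p) * D (f i) := by
  induction p using MvPolynomial.induction_on with
  | C a => simp
  | add p q hp hq => simp only [map_add, hp, hq, add_mul, Finset.sum_add_distrib]
  | mul_X p j hp =>
    simp only [map_mul, MvPolynomial.aeval_X, Derivation.leibniz, hp, smul_eq_mul, map_add,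
      MvPolynomial.pderiv_X, add_mul, Finset.sum_add_distrib, Finset.mul_sum]
    congr 1
    · rw [Finset.sum_eq_single j]
      · simp
      · intro i _ hij
        simp [Pi.single_eq_of_ne' hij]
      · simp
    · exact Finset.sum_congr rfl fun i _ => by ring

/-- The Euler operator `p ↦ (x - x₀) · ∇p`. -/
def euler {d : ℕ} (x₀ : EuclideanSpace ℝ (Fin d)) :
    MvPolynomial (Fin d) ℝ →ₗ[ℝ] MvPolynomial (Fin d) ℝ :=
  ∑ i, LinearMap.mulLeft ℝ (shiftedPosition x₀ i) ∘ₗ (MvPolynomial.pderiv i).toLinearMap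

theorem euler_apply {d : ℕ} (x₀ : EuclideanSpace ℝ (Fin d)) (p : MvPolynomial (Fin d) ℝ) :
    euler x₀ p = ∑ i, shiftedPosition x₀ i * MvPolynomial.pderiv i p := by
  simp [euler]

/-- The restriction of a polynomial to the line through `x₀` and `y`. -/
def lineHom {d : ℕ} (x₀ : EuclideanSpace ℝ (Fin d)) (y : Fin d → ℝ) :
    MvPolynomial (Fin d) ℝ →ₐ[ℝ] Polynomial ℝ :=
  MvPolynomial.aeval fun i => Polynomial.C (x₀ i) + Polynomial.X * Polynomial.C (y i - x₀ i)

theorem eval_lineHom {d : ℕ} (x₀ : EuclideanSpace ℝ (Fin d)) (y : Fin d → ℝ) (t : ℝ)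
    (p : MvPolynomial (Fin d) ℝ) :
    (lineHom x₀ y p).eval t = MvPolynomial.eval (fun i => x₀ i + t * (y i - x₀ i)) p := by
  induction p using MvPolynomial.induction_on with
  | C a => simp [lineHom]
  | add p q hp hq => simp [hp, hq]
  | mul_X p j hp => simp only [map_mul, Polynomial.eval_mul, hp]; simp [lineHom]

/-- Along the ray `t ↦ x₀ + t (y - x₀)` the Euler operator acts as `t d/dt`, which reduces its
kernel to one-variable calculus. -/
theorem lineHom_euler {d : ℕ} (x₀ : EuclideanSpace ℝ (Fin d)) (y : Fin d → ℝ)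
    (p : MvPolynomial (Fin d) ℝ) :
    lineHom x₀ y (euler x₀ p) = Polynomial.X * (lineHom x₀ y p).derivative := by
  have h := derivation_aeval (Polynomial.derivative' (R := ℝ))
    (fun i => Polynomial.C (x₀ i) + Polynomial.X * Polynomial.C (y i - x₀ i)) p
  simp only [Polynomial.derivative'_apply] at h
  rw [lineHom, h, euler_apply, map_sum, Finset.mul_sum]
  refine Finset.sum_congr rfl fun i _ => ?_
  simp [shiftedPosition]
  ring

/-- On each line through `x₀` the restriction has zero derivative, so its values at `t = 1` (the
point `y`) and `t = 0` (the point `x₀`) agree. -/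
theorem eq_C_of_euler_eq_zero {d : ℕ} {x₀ : EuclideanSpace ℝ (Fin d)}
    {p : MvPolynomial (Fin d) ℝ} (h : euler x₀ p = 0) :
    p = MvPolynomial.C (MvPolynomial.eval x₀.ofLp p) := by
  refine MvPolynomial.funext fun y => ?_
  have h1 := lineHom_euler x₀ y p
  rw [h, map_zero, eq_comm, mul_eq_zero, or_iff_right Polynomial.X_ne_zero] at h1
  have h2 := Polynomial.eq_C_of_derivative_eq_zero h1
  have e1 := eval_lineHom x₀ y 1 p
  have e0 := eval_lineHom x₀ y 0 p
  rw [h2] at e1 e0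
  simp only [Polynomial.eval_C, one_mul, zero_mul, add_zero, add_sub_cancel] at e1 e0
  rw [MvPolynomial.eval_C, ← e1, e0]

/-- On a line, `E p + p` becomes `(t f)'`. If it vanishes, `t f` is constant with zero constant
term, hence `f = 0`. -/
theorem eq_zero_of_euler_add_self_eq_zero {d : ℕ} {x₀ : EuclideanSpace ℝ (Fin d)}
    {p : MvPolynomial (Fin d) ℝ} (h : euler x₀ p + p = 0) : p = 0 := by
  refine MvPolynomial.funext fun y => ?_
  have h1 : (Polynomial.X * lineHom x₀ y p).derivative = 0 := by
    rw [Polynomial.derivative_mul, ← lineHom_euler, Polynomial.derivative_X, one_mul, ← map_add,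
      add_comm, h, map_zero]
  have h2 := Polynomial.eq_C_of_derivative_eq_zero h1
  simp only [Polynomial.coeff_X_mul_zero, map_zero, mul_eq_zero, Polynomial.X_ne_zero,
    false_or] at h2
  have e1 := eval_lineHom x₀ y 1 p
  rw [h2] at e1
  simpa using e1.symm

theorem shiftedPosition_mem {d : ℕ} (x₀ : EuclideanSpace ℝ (Fin d)) (i : Fin d) :
    shiftedPosition x₀ i ∈ Poly d 1 := by
  rw [MvPolynomial.mem_restrictTotalDegree, shiftedPosition]
  exact (MvPolynomial.totalDegree_sub_C_le _ _).trans (MvPolynomial.totalDegree_X _).le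

theorem mul_mem_poly {d l m : ℕ} {p q : MvPolynomial (Fin d) ℝ} (hp : p ∈ Poly d l)
    (hq : q ∈ Poly d m) : p * q ∈ Poly d (l + m) := by
  rw [MvPolynomial.mem_restrictTotalDegree] at *
  exact (MvPolynomial.totalDegree_mul _ _).trans (add_le_add hp hq)

theorem pderiv_eq_zero_of_mem_poly_zero {d : ℕ} (i : Fin d) {p : MvPolynomial (Fin d) ℝ}
    (hp : p ∈ Poly d 0) : MvPolynomial.pderiv i p = 0 := by
  rw [MvPolynomial.mem_restrictTotalDegree, Nat.le_zero,
    MvPolynomial.totalDegree_eq_zero_iff_eq_C] at hp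
  rw [hp, MvPolynomial.pderiv_C]

theorem euler_mem {d l : ℕ} (x₀ : EuclideanSpace ℝ (Fin d)) {p : MvPolynomial (Fin d) ℝ}
    (hp : p ∈ Poly d l) : euler x₀ p ∈ Poly d l := by
  rw [euler_apply]
  refine Submodule.sum_mem _ fun i _ => ?_
  cases l with
  | zero => rw [pderiv_eq_zero_of_mem_poly_zero i hp, mul_zero]; exact Submodule.zero_mem _
  | succ l =>
    rw [add_comm l 1]
    exact mul_mem_poly (shiftedPosition_mem x₀ i) (pderiv_mem_poly i hp)

/-- `E + 1` preserves the degree bound and is injective, hence surjective in finite dimension. -/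
theorem exists_euler_add_self_eq {d l : ℕ} (x₀ : EuclideanSpace ℝ (Fin d))
    {p : MvPolynomial (Fin d) ℝ} (hp : p ∈ Poly d l) :
    ∃ w ∈ Poly d l, euler x₀ w + w = p := by
  let Φ : Poly d l →ₗ[ℝ] Poly d l :=
    (euler x₀ + LinearMap.id).restrict fun w hw => Submodule.add_mem _ (euler_mem x₀ hw) hw
  have hΦ : Function.Injective Φ := by
    rw [← LinearMap.ker_eq_bot, LinearMap.ker_eq_bot']
    intro w hw
    exact Subtype.ext (eq_zero_of_euler_add_self_eq_zero (congrArg Subtype.val hw))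
  have := MeshElement.instFiniteDimensionalPoly d l
  obtain ⟨w, hw⟩ := (LinearMap.injective_iff_surjective.1 hΦ) ⟨p, hp⟩
  exact ⟨w, w.2, congrArg Subtype.val hw⟩

/-- This is `y · y^⊥ = 0` in the plane and `y · (y × a) = 0` in space. -/
theorem sum_shiftedPosition_mul_of_mem_koszulPoly {d l : ℕ} (hd : d = 2 ∨ d = 3)
    {x₀ : EuclideanSpace ℝ (Fin d)} {c : Fin d → MvPolynomial (Fin d) ℝ}
    (hc : c ∈ koszulPoly d x₀ l) : ∑ i, shiftedPosition x₀ i * c i = 0 := by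
  rcases hd with rfl | rfl
  · cases l with
    | zero => rw [(Submodule.mem_bot ℝ).1 hc]; simp
    | succ l =>
      obtain ⟨a, -, rfl⟩ := hc
      simp [Fin.sum_univ_two]
      ring
  · cases l with
    | zero => rw [(Submodule.mem_bot ℝ).1 hc]; simp
    | succ l =>
      obtain ⟨a, -, rfl⟩ := hc
      simp [Fin.sum_univ_three, cross_apply]
      ring

/-- The field `x ↦ (∇w - ∇wᵀ)(x - x₀)` belongs to the Koszul complement. -/
theorem sum_mul_pderiv_sub_mem_koszulPoly {d l : ℕ} (hd : d = 2 ∨ d = 3)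
    (x₀ : EuclideanSpace ℝ (Fin d)) {w : Fin d → MvPolynomial (Fin d) ℝ}
    (hw : ∀ i, w i ∈ Poly d l) :
    (fun i => ∑ j, shiftedPosition x₀ j *
      (MvPolynomial.pderiv i (w j) - MvPolynomial.pderiv j (w i))) ∈ koszulPoly d x₀ l := by
  cases l with
  | zero =>
    convert Submodule.zero_mem (koszulPoly d x₀ 0) with i
    simp [pderiv_eq_zero_of_mem_poly_zero _ (hw _)]
  | succ l =>
    have hmem (i j k m : Fin d) :
        MvPolynomial.pderiv i (w j) - MvPolynomial.pderiv k (w m) ∈ Poly d l :=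
      Submodule.sub_mem _ (pderiv_mem_poly i (hw j)) (pderiv_mem_poly k (hw m))
    rcases hd with rfl | rfl
    -- In the plane the coefficient is minus the scalar curl of `w`.
    · refine ⟨_, hmem 1 0 0 1, ?_⟩
      ext1 i
      fin_cases i <;> simp [Fin.sum_univ_two]
      ring
    -- In space the second factor of the cross product is `curl w`.
    · refine ⟨![MvPolynomial.pderiv 1 (w 2) - MvPolynomial.pderiv 2 (w 1),
        MvPolynomial.pderiv 2 (w 0) - MvPolynomial.pderiv 0 (w 2),
        MvPolynomial.pderiv 0 (w 1) - MvPolynomial.pderiv 1 (w 0)], ?_, ?_⟩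
      · intro i _
        fin_cases i <;> exact hmem _ _ _ _
      · ext1 i
        fin_cases i <;> simp [Fin.sum_univ_three, cross_apply] <;> ring

/-- The Koszul decomposition of polynomial fields. -/
theorem exists_potential {d l : ℕ} (hd : d = 2 ∨ d = 3) (x₀ : EuclideanSpace ℝ (Fin d))
    (q : PolyVec d l) : ∃ r : Poly d (l + 1), MvPolynomial.eval x₀.ofLp r.1 = 0 ∧
      q.1 - (gradPoly d l r).1 ∈ koszulPoly d x₀ l := by
  -- Componentwise `(E + 1) w_i = q_i`; the potential is `(x - x₀) · w`, as in the Poincaré homotopy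
  -- formula.
  choose w hw hwq using fun i => exists_euler_add_self_eq x₀ (q.2 i trivial)
  refine ⟨⟨∑ j, shiftedPosition x₀ j * w j, ?_⟩, ?_, ?_⟩
  · refine Submodule.sum_mem _ fun j _ => ?_
    rw [add_comm l 1]
    exact mul_mem_poly (shiftedPosition_mem x₀ j) (hw j)
  · simp [shiftedPosition]
  -- By the product rule `∂_i r = w_i + ∑_j (x - x₀)_j ∂_i w_j`, while `q_i = w_i + ∑_j (x - x₀)_j
  -- ∂_j w_i`; the `w_i` cancel in `∇r - q`.
  · rw [← Submodule.neg_mem_iff]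
    convert sum_mul_pderiv_sub_mem_koszulPoly hd x₀ hw using 1
    ext1 i
    have h1 : (gradPoly d l ⟨∑ j, shiftedPosition x₀ j * w j, by
        refine Submodule.sum_mem _ fun j _ => ?_
        rw [add_comm l 1]
        exact mul_mem_poly (shiftedPosition_mem x₀ j) (hw j)⟩).1 i =
        MvPolynomial.pderiv i (∑ j, shiftedPosition x₀ j * w j) := rfl
    have h2 (j : Fin d) : MvPolynomial.pderiv i (shiftedPosition x₀ j) =
        if i = j then 1 else 0 := by
      simp [shiftedPosition, MvPolynomial.pderiv_X, Pi.single_apply, eq_comm]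
    rw [Pi.neg_apply, Pi.sub_apply, h1, ← hwq i, euler_apply]
    simp only [map_sum, MvPolynomial.pderiv_mul, h2, ite_mul, one_mul, zero_mul,
      Finset.sum_add_distrib, Finset.sum_ite_eq, Finset.mem_univ, if_true, mul_sub,
      Finset.sum_sub_distrib]
    ring

theorem euler_eq_of_sub_mem_koszulPoly {d l : ℕ} (hd : d = 2 ∨ d = 3)
    {x₀ : EuclideanSpace ℝ (Fin d)} {q : PolyVec d l} {r : Poly d (l + 1)}
    (h : q.1 - (gradPoly d l r).1 ∈ koszulPoly d x₀ l) :
    euler x₀ r.1 = ∑ i, shiftedPosition x₀ i * q.1 i := by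
  have h1 := sum_shiftedPosition_mul_of_mem_koszulPoly hd h
  simp only [Pi.sub_apply, mul_sub, Finset.sum_sub_distrib] at h1
  rw [euler_apply, sub_eq_zero.1 h1]
  rfl

namespace MeshElement

variable {d : ℕ} (M : MeshElement d)

/-! ### Well-posedness of the potential -/

theorem exists_brokenPotential (hd : d = 2 ∨ d = 3) {l : ℕ} (q : M.BrokenVec l) :
    ∃ r : M.BrokenPoly (l + 1), q - M.grad l r ∈ M.golyC l ∧
      ∀ τ, MvPolynomial.eval M.xT.ofLp (r τ).1 = 0 := by
  choose r hr0 hr using fun τ => exists_potential hd M.xT (q.on τ)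
  exact ⟨r, hr, hr0⟩

theorem brokenPotential_unique (hd : d = 2 ∨ d = 3) {l : ℕ} {q : M.BrokenVec l}
    {r s : M.BrokenPoly (l + 1)}
    (hr : q - M.grad l r ∈ M.golyC l) (hs : q - M.grad l s ∈ M.golyC l)
    (hr0 : ∀ τ, MvPolynomial.eval M.xT.ofLp (r τ).1 = 0)
    (hs0 : ∀ τ, MvPolynomial.eval M.xT.ofLp (s τ).1 = 0) : r = s := by
  funext τ
  have h1 := euler_eq_of_sub_mem_koszulPoly hd (hr τ)
  have h2 := euler_eq_of_sub_mem_koszulPoly hd (hs τ)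
  have h3 : euler M.xT ((r τ).1 - (s τ).1) = 0 := by
    rw [map_sub, sub_eq_zero]; exact h1.trans h2.symm
  have h4 := eq_C_of_euler_eq_zero h3
  rw [map_sub, hr0, hs0, sub_zero, map_zero, sub_eq_zero] at h4
  exact Subtype.ext h4

/-- A gradient that is also a Koszul field has a potential in the kernel of the Euler operator, so
this potential is constant on each simplex. -/
theorem eq_zero_of_mem_goly_of_mem_golyC (hd : d = 2 ∨ d = 3) {l : ℕ} {v : M.BrokenVec l}
    (hg : v ∈ M.goly l) (hc : v ∈ M.golyC l) : v = 0 := by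
  obtain ⟨r, rfl⟩ := hg
  funext τ
  have h1 : euler M.xT (r τ).1 = 0 := by
    rw [euler_apply]
    exact sum_shiftedPosition_mul_of_mem_koszulPoly hd (hc τ)
  have h2 := eq_C_of_euler_eq_zero h1
  refine Subtype.ext (funext fun i => ?_)
  change MvPolynomial.pderiv i (r τ).1 = 0
  rw [h2, MvPolynomial.pderiv_C]

/-- If `v = π_G π_Gc v`, then `‖v‖ ≤ ‖π_Gc v‖ ≤ ‖v‖`. Equality puts `v` in both spaces, so `v = 0`;
injectivity suffices in finite dimension. -/
theorem isUnit_one_sub_projG_mul_projGC (hd : d = 2 ∨ d = 3) (l : ℕ) :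
    IsUnit (1 - M.projG l * M.projGC l) := by
  rw [ContinuousLinearMap.isUnit_iff_bijective]
  have hinj : Function.Injective
      (1 - M.projG l * M.projGC l : M.BrokenVec l →L[ℝ] M.BrokenVec l) := by
    refine (injective_iff_map_eq_zero _).2 fun v hv => ?_
    have hv' : v = (M.goly l).starProjection ((M.golyC l).starProjection v) :=
      sub_eq_zero.1 hv
    have hg : v ∈ M.goly l := by
      rw [hv']; exact Submodule.starProjection_apply_mem _ _
    have hn : ‖(M.golyC l).starProjection v‖ = ‖v‖ := by
      refine le_antisymm (Submodule.norm_starProjection_apply_le _ _) ?_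
      conv_lhs => rw [hv']
      exact Submodule.norm_starProjection_apply_le _ _
    exact M.eq_zero_of_mem_goly_of_mem_golyC hd hg ((Submodule.mem_iff_norm_starProjection _ _).2 hn)
  exact ⟨hinj, LinearMap.injective_iff_surjective
    (f := (1 - M.projG l * M.projGC l : M.BrokenVec l →L[ℝ] M.BrokenVec l).toLinearMap).1 hinj⟩

/-- The two spaces together span, so a vector orthogonal to both is orthogonal to itself. -/
theorem eq_zero_of_projections_eq_zero (hd : d = 2 ∨ d = 3) {l : ℕ} {u : M.BrokenVec l}
    (hg : M.projG l u = 0) (hc : M.projGC l u = 0) : u = 0 := by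
  have hg' : u ∈ (M.goly l)ᗮ := (Submodule.starProjection_apply_eq_zero_iff _).1 hg
  have hc' : u ∈ (M.golyC l)ᗮ := (Submodule.starProjection_apply_eq_zero_iff _).1 hc
  obtain ⟨r, hr, -⟩ := M.exists_brokenPotential hd u
  have h1 := hg' _ ⟨r, rfl⟩
  have h2 := hc' _ hr
  rw [inner_sub_left, h1, sub_zero] at h2
  exact inner_self_eq_zero.1 h2

/-- Applying `Id - π_G π_Gc` to `∇r` gives `π_G ∇r - π_G π_Gc ∇r`, so the formula says that `v = q -
∇r` satisfies `π_G (v - π_Gc v) = 0`. This holds exactly when `v` is Koszul. -/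
theorem isPotential_iff (hd : d = 2 ∨ d = 3) {l : ℕ} (q : M.BrokenVec l)
    (r : M.BrokenPoly (l + 1)) :
    M.IsPotential l q r ↔ q - M.grad l r ∈ M.golyC l ∧
      ∀ τ, MvPolynomial.eval M.xT.ofLp (r τ).1 = 0 := by
  refine and_congr_left fun _ => ?_
  set A := 1 - M.projG l * M.projGC l with hA
  -- `Ring.inverse` is zero off the units, so invertibility is needed before it can be cancelled.
  have hU : IsUnit A := M.isUnit_one_sub_projG_mul_projGC hd l
  have hPg : M.projG l (M.grad l r) = M.grad l r :=
    Submodule.starProjection_eq_self_iff.2 ⟨r, rfl⟩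
  have hAg : A (M.grad l r) =
      M.projG l (M.grad l r) - M.projG l (M.projGC l (M.grad l r)) := by
    rw [hPg]; rfl
  have key : M.grad l r = Ring.inverse A (M.projG l q - M.projG l (M.projGC l q)) ↔
      A (M.grad l r) = M.projG l q - M.projG l (M.projGC l q) := by
    constructor
    · intro h
      rw [h, ← mul_apply_eq_comp, Ring.mul_inverse_cancel _ hU]; rfl
    · intro h
      rw [← h, ← mul_apply_eq_comp, Ring.inverse_mul_cancel _ hU]; rfl
  rw [key, hAg]
  constructor
  · intro h
    set v := q - M.grad l r with hv
    have h1 : M.projG l (v - M.projGC l v) = 0 := by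
      simp only [hv, map_sub]
      rw [← sub_eq_zero] at h
      rw [← neg_eq_zero, ← h]
      abel
    -- The residual `v - π_Gc v` is now annihilated by both projectors, hence zero.
    have h2 : M.projGC l (v - M.projGC l v) = 0 := by
      rw [map_sub, sub_eq_zero]
      exact (Submodule.starProjection_eq_self_iff.2
        (Submodule.starProjection_apply_mem _ _)).symm
    have h3 := sub_eq_zero.1 (M.eq_zero_of_projections_eq_zero hd h1 h2)
    exact Submodule.starProjection_eq_self_iff.1 h3.symm
  · intro h
    have h1 : M.projGC l (q - M.grad l r) = q - M.grad l r :=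
      Submodule.starProjection_eq_self_iff.2 h
    have h2 := congrArg (M.projG l) h1
    simp only [map_sub] at h2
    rw [← sub_eq_zero] at h2 ⊢
    rw [← h2]
    abel

theorem isPotential_iff_eq_potOp (hd : d = 2 ∨ d = 3) {l : ℕ} (q : M.BrokenVec l)
    (r : M.BrokenPoly (l + 1)) : M.IsPotential l q r ↔ r = M.potOp l q := by
  obtain ⟨s, hs⟩ := M.exists_brokenPotential hd q
  have hp : M.IsPotential l q (M.potOp l q) :=
    Classical.epsilon_spec ⟨s, (M.isPotential_iff hd q s).2 hs⟩
  refine ⟨fun hr => ?_, fun h => h ▸ hp⟩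
  have hr' := (M.isPotential_iff hd q r).1 hr
  have hp' := (M.isPotential_iff hd q _).1 hp
  exact M.brokenPotential_unique hd hr'.1 hp'.1 hr'.2 hp'.2

theorem eq_potOp (hd : d = 2 ∨ d = 3) {l : ℕ} {q : M.BrokenVec l} {r : M.BrokenPoly (l + 1)}
    (h : q - M.grad l r ∈ M.golyC l) (h0 : ∀ τ, MvPolynomial.eval M.xT.ofLp (r τ).1 = 0) :
    M.potOp l q = r :=
  ((M.isPotential_iff_eq_potOp hd q r).1 ((M.isPotential_iff hd q r).2 ⟨h, h0⟩)).symm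

theorem potOp_spec (hd : d = 2 ∨ d = 3) {l : ℕ} (q : M.BrokenVec l) :
    q - M.grad l (M.potOp l q) ∈ M.golyC l ∧
      ∀ τ, MvPolynomial.eval M.xT.ofLp (M.potOp l q τ).1 = 0 :=
  (M.isPotential_iff hd q _).1 ((M.isPotential_iff_eq_potOp hd q _).2 rfl)

/-! ### Linearity, consistency and preservation of global polynomials -/

theorem isLinearMap_potOp (hd : d = 2 ∨ d = 3) (l : ℕ) : IsLinearMap ℝ (M.potOp l) where
  map_add p q := by
    obtain ⟨hp, hp0⟩ := M.potOp_spec hd p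
    obtain ⟨hq, hq0⟩ := M.potOp_spec hd q
    refine M.eq_potOp hd ?_ fun τ => ?_
    · rw [map_add, add_sub_add_comm]
      exact Submodule.add_mem _ hp hq
    · change MvPolynomial.eval M.xT.ofLp ((M.potOp l p τ).1 + (M.potOp l q τ).1) = 0
      rw [map_add, hp0, hq0, add_zero]
  map_smul c q := by
    obtain ⟨hq, hq0⟩ := M.potOp_spec hd q
    refine M.eq_potOp hd ?_ fun τ => ?_
    · rw [map_smul, ← smul_sub]
      exact Submodule.smul_mem _ c hq
    · change MvPolynomial.eval M.xT.ofLp (c • (M.potOp l q τ).1) = 0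
      rw [MvPolynomial.smul_eval, hq0, mul_zero]

theorem grad_potOp_of_mem_goly (hd : d = 2 ∨ d = 3) {l : ℕ} {b : M.BrokenVec l}
    (hb : b ∈ M.goly l) : M.grad l (M.potOp l b) = b :=
  (sub_eq_zero.1 (M.eq_zero_of_mem_goly_of_mem_golyC hd
    (Submodule.sub_mem _ hb ⟨_, rfl⟩) (M.potOp_spec hd b).1)).symm

theorem potOp_of_mem_golyC (hd : d = 2 ∨ d = 3) {l : ℕ} {c : M.BrokenVec l}
    (hc : c ∈ M.golyC l) : M.potOp l c = 0 := by
  refine M.eq_potOp hd ?_ fun τ => map_zero _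
  rwa [map_zero, sub_zero]

theorem exists_potOp_ofPolyVec (hd : d = 2 ∨ d = 3) {l : ℕ} (q : PolyVec d l) :
    ∃ p : Poly d (l + 1), M.potOp l (M.ofPolyVec q) = M.ofPoly p := by
  obtain ⟨p, hp0, hp⟩ := exists_potential hd M.xT q
  exact ⟨p, M.eq_potOp hd (fun _ => hp) fun _ => hp0⟩

end MeshElement

/-! ### Comparison of `L²` norms on finite-dimensional spaces of functions -/

theorem norm_sq_toLp {X F : Type*} [MeasurableSpace X] [NormedAddCommGroup F]
    [InnerProductSpace ℝ F] {μ : Measure X} {f : X → F} (hf : MemLp f 2 μ) :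
    ‖hf.toLp f‖ ^ 2 = ∫ x, ‖f x‖ ^ 2 ∂μ := by
  rw [← real_inner_self_eq_norm_sq, L2.inner_def]
  refine integral_congr_ae ?_
  filter_upwards [hf.coeFn_toLp] with x hx
  rw [hx, real_inner_self_eq_norm_sq]

/-- A linear family of square-integrable functions, as a linear map into `L²`. -/
def toL2 {X F V : Type*} [MeasurableSpace X] [NormedAddCommGroup F] [InnerProductSpace ℝ F]
    [AddCommGroup V] [Module ℝ V] {μ : Measure X} (Φ : V →ₗ[ℝ] (X → F))
    (hΦ : ∀ v, MemLp (Φ v) 2 μ) : V →ₗ[ℝ] Lp F 2 μ where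
  toFun v := (hΦ v).toLp (Φ v)
  map_add' v w := by
    rw [← MemLp.toLp_add]
    exact MemLp.toLp_congr _ _ (by rw [map_add])
  map_smul' c v := by
    rw [RingHom.id_apply, ← MemLp.toLp_const_smul]
    exact MemLp.toLp_congr _ _ (by rw [map_smul])

/-- Since `Φ` is injective into `L²`, `Ψ` factors through its finite-dimensional range, where every
linear map is bounded. -/
theorem exists_integral_norm_sq_le {X F G V : Type*} [MeasurableSpace X]
    [NormedAddCommGroup F] [InnerProductSpace ℝ F] [NormedAddCommGroup G] [InnerProductSpace ℝ G]
    [AddCommGroup V] [Module ℝ V] [FiniteDimensional ℝ V] {μ ν : Measure X}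
    (Φ : V →ₗ[ℝ] (X → F)) (Ψ : V →ₗ[ℝ] (X → G))
    (hΦ : ∀ v, MemLp (Φ v) 2 μ) (hΨ : ∀ v, MemLp (Ψ v) 2 ν)
    (hinj : ∀ v, Φ v =ᵐ[μ] 0 → v = 0) :
    ∃ C : ℝ, 0 < C ∧ ∀ v, ∫ x, ‖Ψ v x‖ ^ 2 ∂ν ≤ C * ∫ x, ‖Φ v x‖ ^ 2 ∂μ := by
  let f := toL2 Φ hΦ
  have hf : Function.Injective f := by
    refine (injective_iff_map_eq_zero _).2 fun v hv => hinj v ?_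
    have h1 := (hΦ v).coeFn_toLp
    have h2 : (hΦ v).toLp (Φ v) = 0 := hv
    rw [h2] at h1
    exact h1.symm.trans (Lp.coeFn_zero F 2 μ)
  let e := LinearEquiv.ofInjective f hf
  let T := (toL2 Ψ hΨ ∘ₗ e.symm.toLinearMap).toContinuousLinearMap
  refine ⟨‖T‖ ^ 2 + 1, by positivity, fun v => ?_⟩
  have h1 := T.le_opNorm (e v)
  have h2 : T (e v) = (hΨ v).toLp (Ψ v) := by
    change toL2 Ψ hΨ (e.symm (e v)) = _
    rw [e.symm_apply_apply]; rfl
  have h3 : ‖e v‖ = ‖(hΦ v).toLp (Φ v)‖ := rfl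
  rw [h2, h3] at h1
  rw [← norm_sq_toLp (hΨ v), ← norm_sq_toLp (hΦ v)]
  calc _ ≤ (‖T‖ * ‖(hΦ v).toLp (Φ v)‖) ^ 2 := by gcongr
    _ = ‖T‖ ^ 2 * ‖(hΦ v).toLp (Φ v)‖ ^ 2 := mul_pow _ _ _
    _ ≤ _ := by gcongr; linarith

theorem exists_integral_norm_sq_le_on {X F G V : Type*} [MeasurableSpace X]
    [NormedAddCommGroup F] [InnerProductSpace ℝ F] [NormedAddCommGroup G] [InnerProductSpace ℝ G]
    [AddCommGroup V] [Module ℝ V] [FiniteDimensional ℝ V] {W : Submodule ℝ V} {μ ν : Measure X}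
    (Φ : V →ₗ[ℝ] (X → F)) (Ψ : V →ₗ[ℝ] (X → G))
    (hΦ : ∀ v, MemLp (Φ v) 2 μ) (hΨ : ∀ v, MemLp (Ψ v) 2 ν)
    (hinj : ∀ v ∈ W, Φ v =ᵐ[μ] 0 → v = 0) :
    ∃ C : ℝ, 0 < C ∧ ∀ v ∈ W, ∫ x, ‖Ψ v x‖ ^ 2 ∂ν ≤ C * ∫ x, ‖Φ v x‖ ^ 2 ∂μ := by
  obtain ⟨C, hC, h⟩ := exists_integral_norm_sq_le (Φ ∘ₗ W.subtype) (Ψ ∘ₗ W.subtype)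
    (fun v => hΦ v) (fun v => hΨ v) (fun v hv => Subtype.ext (hinj v v.2 hv))
  exact ⟨C, hC, fun v hv => h ⟨v, hv⟩⟩

/-! ### The local stability bound -/

theorem continuous_evalPoly {d : ℕ} (p : MvPolynomial (Fin d) ℝ) :
    Continuous fun x : EuclideanSpace ℝ (Fin d) => MvPolynomial.eval x.ofLp p :=
  (MvPolynomial.continuous_eval p).comp (PiLp.continuous_ofLp 2 _)

theorem memLp_restrict_of_continuous {E F : Type*} [NormedAddCommGroup E] [ProperSpace E]
    [MeasurableSpace E] [BorelSpace E] [SecondCountableTopology E] [NormedAddCommGroup F]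
    {μ : Measure E} [IsFiniteMeasureOnCompacts μ]
    {f : E → F} (hf : Continuous f) {s : Set E} (hs : Bornology.IsBounded s) :
    MemLp f 2 (μ.restrict s) := by
  have hK : IsCompact (closure s) := hs.isCompact_closure
  obtain ⟨C, hC⟩ := hK.exists_bound_of_continuousOn hf.continuousOn
  have : IsFiniteMeasure (μ.restrict (closure s)) := ⟨by simpa using hK.measure_lt_top⟩
  have h : MemLp f 2 (μ.restrict (closure s)) :=
    MemLp.of_bound hf.aestronglyMeasurable C
      ((ae_restrict_iff' isClosed_closure.measurableSet).2 (Filter.Eventually.of_forall hC))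
  exact h.mono_measure (Measure.restrict_mono subset_closure le_rfl)

/-- The linear map that sends a polynomial field to the function it induces. -/
def evalVecₗ (d : ℕ) : (Fin d → MvPolynomial (Fin d) ℝ) →ₗ[ℝ]
    (EuclideanSpace ℝ (Fin d) → EuclideanSpace ℝ (Fin d)) where
  toFun := evalVec
  map_add' p q := by ext y i; exact map_add _ _ _
  map_smul' c p := by ext y i; exact MvPolynomial.smul_eval _ _ _

/-- The linear map that sends a polynomial to the function it induces. -/
def evalPolyₗ (d : ℕ) : MvPolynomial (Fin d) ℝ →ₗ[ℝ] (EuclideanSpace ℝ (Fin d) → ℝ) where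
  toFun p x := MvPolynomial.eval x.ofLp p
  map_add' p q := by ext y; exact map_add _ _ _
  map_smul' c p := by ext y; exact MvPolynomial.smul_eval _ _ _

/-- The pairs `(q, r)` such that `r` vanishes at `x₀` and `(x - x₀) · ∇r = (x - x₀) · q`. -/
def potentialPairs (d l : ℕ) (x₀ : EuclideanSpace ℝ (Fin d)) :
    Submodule ℝ ((Fin d → Poly d l) × Poly d (l + 1)) where
  carrier := {v | MvPolynomial.eval x₀.ofLp v.2.1 = 0 ∧
    euler x₀ v.2.1 = ∑ i, shiftedPosition x₀ i * (v.1 i).1}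
  zero_mem' := by simp
  add_mem' {v w} hv hw := by
    refine ⟨?_, ?_⟩
    · change MvPolynomial.eval x₀.ofLp (v.2.1 + w.2.1) = 0
      rw [map_add, hv.1, hw.1, add_zero]
    · change euler x₀ (v.2.1 + w.2.1) = ∑ i, shiftedPosition x₀ i * ((v.1 i).1 + (w.1 i).1)
      simp only [map_add, hv.2, hw.2, mul_add, Finset.sum_add_distrib]
  smul_mem' c v hv := by
    refine ⟨?_, ?_⟩
    · change MvPolynomial.eval x₀.ofLp (c • v.2.1) = 0
      rw [MvPolynomial.smul_eval, hv.1, mul_zero]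
    · change euler x₀ (c • v.2.1) = ∑ i, shiftedPosition x₀ i * (c • (v.1 i).1)
      simp only [map_smul, hv.2, mul_smul_comm, Finset.smul_sum]

theorem mem_potentialPairs {d l : ℕ} {x₀ : EuclideanSpace ℝ (Fin d)}
    {v : (Fin d → Poly d l) × Poly d (l + 1)} :
    v ∈ potentialPairs d l x₀ ↔ MvPolynomial.eval x₀.ofLp v.2.1 = 0 ∧
      euler x₀ v.2.1 = ∑ i, shiftedPosition x₀ i * (v.1 i).1 :=
  Iff.rfl

theorem eq_zero_of_evalVec_ae_eq_zero {d : ℕ} {q : Fin d → MvPolynomial (Fin d) ℝ}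
    {U : Set (EuclideanSpace ℝ (Fin d))} (hU : IsOpen U) (hne : U.Nonempty)
    (h : evalVec q =ᵐ[volume.restrict U] 0) : q = 0 := by
  have h1 := Measure.eqOn_open_of_ae_eq h hU (MeshElement.continuous_evalVec q).continuousOn
    continuousOn_const
  funext i
  refine MeshElement.polynomial_eq_zero_of_open hU hne fun x hx => ?_
  exact congrArg (fun v : EuclideanSpace ℝ (Fin d) => v i) (h1 hx)

/-- If `q` vanishes on the small ball, it vanishes as a polynomial; then `E r = 0` and `r(0) = 0`
give `r = 0`. Thus the `L²` norm of `q` alone is a norm on the pairs. -/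
theorem exists_bound_on_ball (d l : ℕ) (c : EuclideanSpace ℝ (Fin d)) {ε : ℝ} (hε : 0 < ε) :
    ∃ C : ℝ, 0 < C ∧ ∀ v ∈ potentialPairs d l 0,
      (∫ x in Metric.closedBall (0 : EuclideanSpace ℝ (Fin d)) 1,
          ‖MvPolynomial.eval x.ofLp v.2.1‖ ^ 2) +
        ∫ x in Metric.closedBall (0 : EuclideanSpace ℝ (Fin d)) 1,
          ‖evalVec (gradPoly d l v.2).1 x‖ ^ 2 ≤
      C * ∫ x in Metric.ball c ε, ‖evalVec (fun i => (v.1 i).1) x‖ ^ 2 := by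
  let Φ : (Fin d → Poly d l) × Poly d (l + 1) →ₗ[ℝ]
      (EuclideanSpace ℝ (Fin d) → EuclideanSpace ℝ (Fin d)) :=
    evalVecₗ d ∘ₗ LinearMap.pi (fun i => (Poly d l).subtype ∘ₗ LinearMap.proj i) ∘ₗ
      LinearMap.fst ℝ _ _
  let Ψ₁ : (Fin d → Poly d l) × Poly d (l + 1) →ₗ[ℝ] (EuclideanSpace ℝ (Fin d) → ℝ) :=
    evalPolyₗ d ∘ₗ (Poly d (l + 1)).subtype ∘ₗ LinearMap.snd ℝ _ _
  let Ψ₂ : (Fin d → Poly d l) × Poly d (l + 1) →ₗ[ℝ]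
      (EuclideanSpace ℝ (Fin d) → EuclideanSpace ℝ (Fin d)) :=
    evalVecₗ d ∘ₗ (PolyVec d l).subtype ∘ₗ gradPoly d l ∘ₗ LinearMap.snd ℝ _ _
  have hΦ (v) : MemLp (Φ v) 2 (volume.restrict (Metric.ball c ε)) :=
    memLp_restrict_of_continuous (MeshElement.continuous_evalVec _) Metric.isBounded_ball
  have hΨ₁ (v) : MemLp (Ψ₁ v) 2
      (volume.restrict (Metric.closedBall (0 : EuclideanSpace ℝ (Fin d)) 1)) :=
    memLp_restrict_of_continuous (continuous_evalPoly _) Metric.isBounded_closedBall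
  have hΨ₂ (v) : MemLp (Ψ₂ v) 2
      (volume.restrict (Metric.closedBall (0 : EuclideanSpace ℝ (Fin d)) 1)) :=
    memLp_restrict_of_continuous (MeshElement.continuous_evalVec _) Metric.isBounded_closedBall
  have hinj (v) (hvP : v ∈ potentialPairs d l 0)
      (hv : Φ v =ᵐ[volume.restrict (Metric.ball c ε)] 0) : v = 0 := by
    obtain ⟨h0, he⟩ := mem_potentialPairs.1 hvP
    have hq : (fun i => (v.1 i).1) = 0 :=
      eq_zero_of_evalVec_ae_eq_zero Metric.isOpen_ball ⟨c, Metric.mem_ball_self hε⟩ hv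
    have hq' (i : Fin d) : (v.1 i).1 = 0 := congrFun hq i
    have he' : euler 0 v.2.1 = 0 := by
      rw [he]; exact Finset.sum_eq_zero fun i _ => by rw [hq', mul_zero]
    have hr := eq_C_of_euler_eq_zero he'
    rw [h0, map_zero] at hr
    exact Prod.ext (funext fun i => Subtype.ext (hq' i)) (Subtype.ext hr)
  obtain ⟨C₁, hC₁, h₁⟩ := exists_integral_norm_sq_le_on Φ Ψ₁ hΦ hΨ₁ hinj
  obtain ⟨C₂, hC₂, h₂⟩ := exists_integral_norm_sq_le_on Φ Ψ₂ hΦ hΨ₂ hinj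
  refine ⟨C₁ + C₂, by positivity, fun v hv => ?_⟩
  rw [add_mul]
  exact add_le_add (h₁ v hv) (h₂ v hv)

theorem setIntegral_norm_sq_mono {E F : Type*} [NormedAddCommGroup E] [ProperSpace E]
    [MeasurableSpace E] [BorelSpace E] [SecondCountableTopology E] [NormedAddCommGroup F]
    {μ : Measure E} [IsFiniteMeasureOnCompacts μ]
    {f : E → F} (hf : Continuous f) {s t : Set E} (hst : s ⊆ t) (ht : Bornology.IsBounded t) :
    ∫ x in s, ‖f x‖ ^ 2 ∂μ ≤ ∫ x in t, ‖f x‖ ^ 2 ∂μ :=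
  setIntegral_mono_set ((memLp_restrict_of_continuous hf ht).integrable_norm_pow two_ne_zero)
    (Filter.Eventually.of_forall fun x => by positivity) hst.eventuallyLE

/-- The bound on the unit ball, with a constant that does not depend on the centre of the small
ball. -/
theorem exists_bound_on_unit_ball (d l : ℕ) {ε : ℝ} (hε : 0 < ε) :
    ∃ C : ℝ, 0 < C ∧ ∀ c : EuclideanSpace ℝ (Fin d), ‖c‖ ≤ 1 → ∀ v ∈ potentialPairs d l 0,
      (∫ x in Metric.closedBall (0 : EuclideanSpace ℝ (Fin d)) 1,
          ‖MvPolynomial.eval x.ofLp v.2.1‖ ^ 2) +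
        ∫ x in Metric.closedBall (0 : EuclideanSpace ℝ (Fin d)) 1,
          ‖evalVec (gradPoly d l v.2).1 x‖ ^ 2 ≤
      C * ∫ x in Metric.ball c ε, ‖evalVec (fun i => (v.1 i).1) x‖ ^ 2 := by
  -- With a finite cover by balls of radius `ε / 2`, each admissible ball of radius `ε` contains one
  -- of finitely many fixed balls.
  obtain ⟨t, -, ht, hcov⟩ :=
    (isCompact_closedBall (0 : EuclideanSpace ℝ (Fin d)) 1).finite_cover_balls (half_pos hε)
  choose C hC h using fun c => exists_bound_on_ball d l c (half_pos hε)
  refine ⟨∑ c ∈ ht.toFinset, C c + 1,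
    add_pos_of_nonneg_of_pos (Finset.sum_nonneg fun c _ => (hC c).le) one_pos,
    fun c hc v hv => ?_⟩
  obtain ⟨c', hc', hcc'⟩ := Set.mem_iUnion₂.1 (hcov (mem_closedBall_zero_iff.2 hc))
  refine (h c' v hv).trans ?_
  have hle : C c' ≤ ∑ c ∈ ht.toFinset, C c + 1 :=
    (Finset.single_le_sum (fun c _ => (hC c).le) (ht.mem_toFinset.2 hc')).trans
      (le_add_of_nonneg_right zero_le_one)
  have hsub : Metric.ball c' (ε / 2) ⊆ Metric.ball c ε := by
    refine Metric.ball_subset_ball' ?_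
    rw [Metric.mem_ball, dist_comm] at hcc'
    linarith
  exact mul_le_mul hle
    (setIntegral_norm_sq_mono (MeshElement.continuous_evalVec _) hsub Metric.isBounded_ball)
    (integral_nonneg fun x => by positivity) ((hC c').le.trans hle)

/-! ### Scaling -/

/-- Composition of a polynomial with `y ↦ x₀ + h y`. -/
def affineHom {d : ℕ} (x₀ : EuclideanSpace ℝ (Fin d)) (h : ℝ) :
    MvPolynomial (Fin d) ℝ →ₐ[ℝ] MvPolynomial (Fin d) ℝ :=
  MvPolynomial.aeval fun i => MvPolynomial.C (x₀ i) + MvPolynomial.C h * MvPolynomial.X i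

theorem eval_affineHom {d : ℕ} (x₀ y : EuclideanSpace ℝ (Fin d)) (h : ℝ)
    (p : MvPolynomial (Fin d) ℝ) :
    MvPolynomial.eval y.ofLp (affineHom x₀ h p) = MvPolynomial.eval (x₀ + h • y).ofLp p := by
  induction p using MvPolynomial.induction_on with
  | C a => simp [affineHom]
  | add p q hp hq => simp only [map_add, hp, hq]
  | mul_X p j hp => simp only [map_mul, hp]; simp [affineHom]

theorem pderiv_affineHom {d : ℕ} (x₀ : EuclideanSpace ℝ (Fin d)) (h : ℝ) (i : Fin d)
    (p : MvPolynomial (Fin d) ℝ) :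
    MvPolynomial.pderiv i (affineHom x₀ h p) =
      h • affineHom x₀ h (MvPolynomial.pderiv i p) := by
  rw [affineHom, derivation_aeval, Finset.sum_eq_single i]
  · simp [MvPolynomial.smul_eq_C_mul, mul_comm]
  · intro j _ hj
    simp [MvPolynomial.pderiv_X_of_ne hj]
  · simp

theorem affineHom_mem {d l : ℕ} (x₀ : EuclideanSpace ℝ (Fin d)) (h : ℝ)
    {p : MvPolynomial (Fin d) ℝ} (hp : p ∈ Poly d l) : affineHom x₀ h p ∈ Poly d l := by
  rw [affineHom, MvPolynomial.aeval_def, MvPolynomial.eval₂_eq']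
  refine Submodule.sum_mem _ fun s hs => ?_
  rw [MvPolynomial.mem_restrictTotalDegree] at hp ⊢
  have hX (i : Fin d) : (MvPolynomial.C (x₀ i) + MvPolynomial.C h * MvPolynomial.X i :
      MvPolynomial (Fin d) ℝ).totalDegree ≤ 1 := by
    refine (MvPolynomial.totalDegree_add _ _).trans (max_le (by simp) ?_)
    refine (MvPolynomial.totalDegree_mul _ _).trans ?_
    simp
  calc _ ≤ 0 + ∑ i, s i * 1 := by
        refine (MvPolynomial.totalDegree_mul _ _).trans (add_le_add ?_ ?_)
        · exact (MvPolynomial.totalDegree_C _).le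
        · refine (MvPolynomial.totalDegree_finsetProd _ _).trans
            (Finset.sum_le_sum fun i _ => ?_)
          exact (MvPolynomial.totalDegree_pow _ _).trans (Nat.mul_le_mul_left _ (hX i))
    _ = s.sum fun _ e => e := by
        rw [Finsupp.sum_fintype _ _ fun _ => rfl]; simp
    _ ≤ l := (MvPolynomial.le_totalDegree hs).trans hp

theorem setIntegral_comp_affine {E F : Type*} [NormedAddCommGroup E] [NormedSpace ℝ E]
    [MeasurableSpace E] [BorelSpace E] [FiniteDimensional ℝ E] [NormedAddCommGroup F]
    [NormedSpace ℝ F] (μ : Measure E) [μ.IsAddHaarMeasure] (f : E → F) (x₀ : E) {h : ℝ}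
    (hh : 0 < h) {s : Set E} (hs : MeasurableSet s) :
    ∫ y in (fun y => x₀ + h • y) ⁻¹' s, f (x₀ + h • y) ∂μ =
      (h ^ Module.finrank ℝ E)⁻¹ • ∫ x in s, f x ∂μ := by
  have hm : Measurable fun y : E => x₀ + h • y := by fun_prop
  rw [← integral_indicator hs, ← integral_indicator (hm hs)]
  have h1 := Measure.integral_comp_smul_of_nonneg μ (fun y => s.indicator f (x₀ + y)) h
    (hR := hh.le)
  rw [integral_add_left_eq_self] at h1
  rw [← h1]
  rfl

/-- The field is pulled back unscaled and the potential is divided by `h`; the gradient of the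
rescaled potential is then the pullback of `∇r`, and the Euler relation survives. -/
theorem smul_affineHom_mem_potentialPairs {d l : ℕ} {x₀ : EuclideanSpace ℝ (Fin d)} {h : ℝ}
    (hh : 0 < h) {v : (Fin d → Poly d l) × Poly d (l + 1)} (hv : v ∈ potentialPairs d l x₀) :
    ((fun i => ⟨affineHom x₀ h (v.1 i).1, affineHom_mem x₀ h (v.1 i).2⟩,
      ⟨h⁻¹ • affineHom x₀ h v.2.1, Submodule.smul_mem _ _ (affineHom_mem x₀ h v.2.2)⟩) :
      (Fin d → Poly d l) × Poly d (l + 1)) ∈ potentialPairs d l 0 := by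
  refine ⟨?_, ?_⟩
  · change MvPolynomial.eval _ (h⁻¹ • affineHom x₀ h v.2.1) = 0
    rw [MvPolynomial.smul_eval, eval_affineHom, smul_zero, add_zero, hv.1, mul_zero]
  · change euler 0 (h⁻¹ • affineHom x₀ h v.2.1) =
      ∑ i, shiftedPosition 0 i * affineHom x₀ h (v.1 i).1
    have hX (i : Fin d) : affineHom x₀ h (shiftedPosition x₀ i) =
        h • shiftedPosition (0 : EuclideanSpace ℝ (Fin d)) i := by
      simp [affineHom, shiftedPosition, MvPolynomial.smul_eq_C_mul, MvPolynomial.algebraMap_eq]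
    have h1 := congrArg (affineHom x₀ h) hv.2
    rw [euler_apply] at h1
    simp only [map_sum, map_mul, hX, smul_mul_assoc, ← Finset.smul_sum] at h1
    have h2 := smul_right_injective _ hh.ne' h1
    rw [← h2, map_smul, euler_apply]
    simp only [pderiv_affineHom, mul_smul_comm, ← Finset.smul_sum]
    rw [inv_smul_smul₀ hh.ne']

theorem exists_bound_on_scaled_ball (d l : ℕ) {ε : ℝ} (hε : 0 < ε) :
    ∃ C : ℝ, 0 < C ∧ ∀ (x₀ c : EuclideanSpace ℝ (Fin d)) (h : ℝ), 0 < h → dist c x₀ ≤ h →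
      ∀ v ∈ potentialPairs d l x₀,
      (∫ x in Metric.closedBall x₀ h, ‖MvPolynomial.eval x.ofLp v.2.1‖ ^ 2) +
        h ^ 2 * ∫ x in Metric.closedBall x₀ h, ‖evalVec (gradPoly d l v.2).1 x‖ ^ 2 ≤
      C * h ^ 2 * ∫ x in Metric.ball c (ε * h), ‖evalVec (fun i => (v.1 i).1) x‖ ^ 2 := by
  obtain ⟨C, hC, hb⟩ := exists_bound_on_unit_ball d l hε
  refine ⟨C, hC, fun x₀ c h hh hc v hv => ?_⟩
  have hdist (y z : EuclideanSpace ℝ (Fin d)) :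
      dist (x₀ + h • y) (x₀ + h • z) = h * dist y z := by
    rw [dist_add_left, dist_smul₀, Real.norm_of_nonneg hh.le]
  have hcc : x₀ + h • (h⁻¹ • (c - x₀)) = c := by
    rw [smul_inv_smul₀ hh.ne', add_sub_cancel]
  have hball : (fun y => x₀ + h • y) ⁻¹' Metric.ball c (ε * h) =
      Metric.ball (h⁻¹ • (c - x₀)) ε := by
    ext y
    conv_lhs => rw [Set.mem_preimage, Metric.mem_ball, ← hcc, hdist, mul_comm h]
    exact mul_lt_mul_iff_left₀ hh
  have hclosed : (fun y => x₀ + h • y) ⁻¹' Metric.closedBall x₀ h =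
      Metric.closedBall (0 : EuclideanSpace ℝ (Fin d)) 1 := by
    ext y
    have := hdist y 0
    rw [smul_zero, add_zero] at this
    rw [Set.mem_preimage, Metric.mem_closedBall, this, Metric.mem_closedBall]
    exact mul_le_iff_le_one_right hh
  have h1 := hb (h⁻¹ • (c - x₀)) (by
    rw [norm_smul, norm_inv, Real.norm_of_nonneg hh.le, ← dist_eq_norm,
      inv_mul_le_iff₀ hh, mul_one]
    exact hc) _ (smul_affineHom_mem_potentialPairs hh hv)
  have hgrad (y : EuclideanSpace ℝ (Fin d)) :
      evalVec (gradPoly d l ⟨h⁻¹ • affineHom x₀ h v.2.1,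
        Submodule.smul_mem _ _ (affineHom_mem x₀ h v.2.2)⟩).1 y =
      evalVec (gradPoly d l v.2).1 (x₀ + h • y) := by
    ext i
    change MvPolynomial.eval y.ofLp (MvPolynomial.pderiv i (h⁻¹ • affineHom x₀ h v.2.1)) =
      MvPolynomial.eval (x₀ + h • y).ofLp (MvPolynomial.pderiv i v.2.1)
    rw [Derivation.map_smul, pderiv_affineHom, inv_smul_smul₀ hh.ne', eval_affineHom]
  have hval (y : EuclideanSpace ℝ (Fin d)) :
      evalVec (fun i => affineHom x₀ h (v.1 i).1) y =
      evalVec (fun i => (v.1 i).1) (x₀ + h • y) := by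
    ext i
    exact eval_affineHom _ _ _ _
  simp only [hgrad, hval, MvPolynomial.smul_eval, eval_affineHom, norm_mul, mul_pow,
    integral_const_mul] at h1
  rw [← hball, ← hclosed,
    setIntegral_comp_affine volume (fun x => ‖MvPolynomial.eval x.ofLp v.2.1‖ ^ 2) x₀ hh
      measurableSet_closedBall,
    setIntegral_comp_affine volume (fun x => ‖evalVec (gradPoly d l v.2).1 x‖ ^ 2) x₀ hh
      measurableSet_closedBall,
    setIntegral_comp_affine volume (fun x => ‖evalVec (fun i => (v.1 i).1) x‖ ^ 2) x₀ hh
      measurableSet_ball, norm_inv, Real.norm_of_nonneg hh.le] at h1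
  simp only [smul_eq_mul] at h1
  have hk : 0 < h ^ Module.finrank ℝ (EuclideanSpace ℝ (Fin d)) := by positivity
  generalize h ^ Module.finrank ℝ (EuclideanSpace ℝ (Fin d)) = k at h1 hk
  generalize (∫ x in Metric.ball c (ε * h), ‖evalVec (fun i => (v.1 i).1) x‖ ^ 2) = I at h1 ⊢
  generalize (∫ x in Metric.closedBall x₀ h, ‖MvPolynomial.eval x.ofLp v.2.1‖ ^ 2) = I₁ at h1 ⊢
  generalize (∫ x in Metric.closedBall x₀ h, ‖evalVec (gradPoly d l v.2).1 x‖ ^ 2) = I₂ at h1 ⊢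
  -- The factor `k = h ^ d` removes the Jacobians, and `h ^ 2` undoes the scaling of the potential.
  have h2 := mul_le_mul_of_nonneg_left h1 (mul_pos (pow_pos hh 2) hk).le
  have e₁ : h ^ 2 * k * (h⁻¹ ^ 2 * (k⁻¹ * I₁) + k⁻¹ * I₂) = I₁ + h ^ 2 * I₂ := by field_simp
  have e₂ : h ^ 2 * k * (C * (k⁻¹ * I)) = C * h ^ 2 * I := by field_simp
  rwa [e₁, e₂] at h2

namespace MeshElement

variable {d : ℕ} (M : MeshElement d)

/-! ### Geometry of the submesh and the global bound -/

theorem diam_convexHull_pos (hd : d ≠ 0) (τ : M.simplices) :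
    0 < Metric.diam (convexHull ℝ (τ.1 : Set (EuclideanSpace ℝ (Fin d)))) := by
  have hcard : 1 < τ.1.card := by rw [M.card_vertices τ.1 τ.2]; omega
  obtain ⟨a, ha, b, hb, hab⟩ := Finset.one_lt_card.1 hcard
  exact (dist_pos.2 hab).trans_le (Metric.dist_le_diam_of_mem
    (isBounded_convexHull.2 τ.1.finite_toSet.isBounded)
    (subset_convexHull ℝ _ ha) (subset_convexHull ℝ _ hb))

theorem diam_convexHull_le_diam (τ : M.simplices) :
    Metric.diam (convexHull ℝ (τ.1 : Set (EuclideanSpace ℝ (Fin d)))) ≤ M.diam := by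
  rw [diam, ← Metric.diam_closure M.T]
  refine Metric.diam_mono ?_ M.isBounded_T.closure
  rw [M.closure_eq]
  exact Set.subset_biUnion_of_mem (u := fun τ : Finset (EuclideanSpace ℝ (Fin d)) =>
    convexHull ℝ (τ : Set (EuclideanSpace ℝ (Fin d)))) τ.2

theorem convexHull_subset_closedBall (τ : M.simplices) :
    convexHull ℝ (τ.1 : Set (EuclideanSpace ℝ (Fin d))) ⊆ Metric.closedBall M.xT
      (Metric.diam (convexHull ℝ (τ.1 : Set (EuclideanSpace ℝ (Fin d))))) := fun _ hx =>
  Metric.dist_le_diam_of_mem (isBounded_convexHull.2 τ.1.finite_toSet.isBounded) hx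
    (subset_convexHull ℝ _ (M.xT_mem τ.1 τ.2))

/-- The inradius is a supremum, possibly not known to be attained; halving `ρ` gives a strictly
smaller radius, for which an inscribed ball exists. -/
theorem exists_ball_subset_openSimplex (hd : d ≠ 0) {ρ : ℝ} (hρ : 0 < ρ) (hM : M.IsRegular ρ)
    (τ : M.simplices) :
    ∃ c, dist c M.xT ≤ Metric.diam (convexHull ℝ (τ.1 : Set (EuclideanSpace ℝ (Fin d)))) ∧
      Metric.ball c (ρ / 2 * Metric.diam
        (convexHull ℝ (τ.1 : Set (EuclideanSpace ℝ (Fin d))))) ⊆ M.openSimplex τ := by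
  set K := convexHull ℝ (τ.1 : Set (EuclideanSpace ℝ (Fin d))) with hK
  have hpos : 0 < Metric.diam K := M.diam_convexHull_pos hd τ
  have hlt : ρ / 2 * Metric.diam K < inradius K := by
    refine lt_of_lt_of_le ?_ (hM.shape τ.1 τ.2)
    have := mul_pos hρ hpos
    linarith
  have hne : {r : ℝ | 0 ≤ r ∧ ∃ c, Metric.closedBall c r ⊆ K}.Nonempty := by
    refine ⟨0, le_rfl, M.xT, ?_⟩
    rw [Metric.closedBall_zero, Set.singleton_subset_iff]
    exact subset_convexHull ℝ _ (M.xT_mem τ.1 τ.2)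
  obtain ⟨r, ⟨hr0, c, hc⟩, hr⟩ := exists_lt_of_lt_csSup hne hlt
  refine ⟨c, M.convexHull_subset_closedBall τ (hc (Metric.mem_closedBall_self hr0)), ?_⟩
  refine interior_maximal (fun x hx => hc ?_) Metric.isOpen_ball
  exact (Metric.mem_ball.1 hx).le.trans hr.le

/-- The squared `L²(T)` norm of a broken function is the sum of those on the simplices. -/
theorem l2norm_sum_indicator {F : Type*} [NormedAddCommGroup F]
    {f : M.simplices → EuclideanSpace ℝ (Fin d) → F} (hf : ∀ τ, Continuous (f τ)) :
    M.l2norm (fun x => ∑ τ, (M.openSimplex τ).indicator (f τ) x) =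
      Real.sqrt (∑ τ, ∫ x in M.openSimplex τ, ‖f τ x‖ ^ 2) := by
  -- At most one summand is nonzero at each point because the open simplices are disjoint, so
  -- squaring commutes with the sum.
  have hpt (x : EuclideanSpace ℝ (Fin d)) :
      ‖∑ τ, (M.openSimplex τ).indicator (f τ) x‖ ^ 2 =
        ∑ τ, (M.openSimplex τ).indicator (fun y => ‖f τ y‖ ^ 2) x := by
    by_cases hx : ∃ τ, x ∈ M.openSimplex τ
    · obtain ⟨τ, hτ⟩ := hx
      have hne (τ' : M.simplices) (h : τ' ≠ τ) : x ∉ M.openSimplex τ' := fun h' =>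
        Set.disjoint_left.1 (M.disjoint_openSimplex h) h' hτ
      rw [Finset.sum_eq_single τ (fun τ' _ h => Set.indicator_of_notMem (hne τ' h) _) (by simp),
        Finset.sum_eq_single τ (fun τ' _ h => Set.indicator_of_notMem (hne τ' h) _) (by simp),
        Set.indicator_of_mem hτ, Set.indicator_of_mem hτ]
    · push Not at hx
      simp [Set.indicator_of_notMem (hx _)]
  have hint (τ : M.simplices) : Integrable ((M.openSimplex τ).indicator
      fun y => ‖f τ y‖ ^ 2) (volume.restrict M.T) :=
    ((memLp_restrict_of_continuous (hf τ) M.isBounded_T).integrable_norm_pow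
      two_ne_zero).indicator (M.isOpen_openSimplex τ).measurableSet
  rw [l2norm]
  simp only [hpt]
  rw [integral_finsetSum _ fun τ _ => hint τ]
  congr 1
  refine Finset.sum_congr rfl fun τ _ => ?_
  rw [setIntegral_indicator (M.isOpen_openSimplex τ).measurableSet,
    Set.inter_eq_self_of_subset_right (M.openSimplex_subset τ)]

theorem l2norm_brokenPoly {l : ℕ} (p : M.BrokenPoly l) :
    M.l2norm p.toFun =
      Real.sqrt (∑ τ, ∫ x in M.openSimplex τ, ‖MvPolynomial.eval x.ofLp (p τ).1‖ ^ 2) :=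
  M.l2norm_sum_indicator fun τ => continuous_evalPoly (p τ).1

theorem l2norm_brokenVec {l : ℕ} (q : M.BrokenVec l) :
    M.l2norm q.toFun =
      Real.sqrt (∑ τ, ∫ x in M.openSimplex τ, ‖evalVec (q.on τ).1 x‖ ^ 2) :=
  M.l2norm_sum_indicator fun τ => continuous_evalVec (q.on τ).1

theorem exists_potOp_bound_on_simplex (hd : d = 2 ∨ d = 3) (l : ℕ) {ρ : ℝ} (hρ : 0 < ρ) :
    ∃ C : ℝ, 0 < C ∧ ∀ M : MeshElement d, M.IsRegular ρ → ∀ (q : M.BrokenVec l) (τ),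
      (∫ x in M.openSimplex τ, ‖MvPolynomial.eval x.ofLp (M.potOp l q τ).1‖ ^ 2) ≤
        C * M.diam ^ 2 * ∫ x in M.openSimplex τ, ‖evalVec (q.on τ).1 x‖ ^ 2 ∧
      (∫ x in M.openSimplex τ, ‖evalVec ((M.grad l (M.potOp l q)).on τ).1 x‖ ^ 2) ≤
        C * ∫ x in M.openSimplex τ, ‖evalVec (q.on τ).1 x‖ ^ 2 := by
  have hd0 : d ≠ 0 := by omega
  obtain ⟨C, hC, hb⟩ := exists_bound_on_scaled_ball d l (half_pos hρ)
  refine ⟨C, hC, fun M hM q τ => ?_⟩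
  obtain ⟨c, hc, hsub⟩ := M.exists_ball_subset_openSimplex hd0 hρ hM τ
  have hh := M.diam_convexHull_pos hd0 τ
  have hhT := M.diam_convexHull_le_diam τ
  have hout : M.openSimplex τ ⊆ _ := _root_.interior_subset.trans (M.convexHull_subset_closedBall τ)
  generalize Metric.diam (convexHull ℝ (τ.1 : Set (EuclideanSpace ℝ (Fin d)))) = h at *
  obtain ⟨hp, hp0⟩ := M.potOp_spec hd q
  have key := hb M.xT c h hh hc
    (fun i => ⟨(q.on τ).1 i, (q.on τ).2 i trivial⟩, M.potOp l q τ)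
    (mem_potentialPairs.2 ⟨hp0 τ, euler_eq_of_sub_mem_koszulPoly hd (hp τ)⟩)
  have hA := setIntegral_norm_sq_mono (μ := volume) (continuous_evalPoly (M.potOp l q τ).1) hout
    Metric.isBounded_closedBall
  have hB := setIntegral_norm_sq_mono (μ := volume)
    (continuous_evalVec (gradPoly d l (M.potOp l q τ)).1) hout Metric.isBounded_closedBall
  have hE := setIntegral_norm_sq_mono (μ := volume) (continuous_evalVec (q.on τ).1) hsub
    (M.isBounded_T.subset (M.openSimplex_subset τ))
  change _ ∧ (∫ x in M.openSimplex τ, ‖evalVec (gradPoly d l (M.potOp l q τ)).1 x‖ ^ 2) ≤ _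
  dsimp only at key
  have hE0 : 0 ≤ ∫ x in M.openSimplex τ, ‖evalVec (q.on τ).1 x‖ ^ 2 :=
    integral_nonneg fun x => by positivity
  have hA0 : 0 ≤ ∫ x in M.openSimplex τ, ‖MvPolynomial.eval x.ofLp (M.potOp l q τ).1‖ ^ 2 :=
    integral_nonneg fun x => by positivity
  have hB0 : 0 ≤ ∫ x in M.openSimplex τ, ‖evalVec (gradPoly d l (M.potOp l q τ)).1 x‖ ^ 2 :=
    integral_nonneg fun x => by positivity
  -- Chain of domains: enlarge the simplex to the ball about `x_T`, apply the scaled bound, then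
  -- enlarge the inscribed ball to the simplex.
  have hmain := (add_le_add hA (mul_le_mul_of_nonneg_left hB (sq_nonneg h))).trans
    (key.trans (mul_le_mul_of_nonneg_left hE (by positivity)))
  constructor
  · refine ((le_add_of_nonneg_right (mul_nonneg (sq_nonneg h) hB0)).trans hmain).trans ?_
    gcongr
  -- The factor `h ^ 2` occurs on both sides and cancels, so the gradient bound is free of scale.
  · have h1 := (le_add_of_nonneg_left hA0).trans hmain
    rw [mul_comm C, mul_assoc] at h1
    exact le_of_mul_le_mul_left h1 (pow_pos hh 2)

theorem exists_potOp_bound (hd : d = 2 ∨ d = 3) (l : ℕ) {ρ : ℝ} (hρ : 0 < ρ) :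
    ∃ C : ℝ, 0 < C ∧ ∀ M : MeshElement d, M.IsRegular ρ → ∀ q : M.BrokenVec l,
      M.l2norm (M.potOp l q).toFun + M.diam * M.l2norm (M.grad l (M.potOp l q)).toFun ≤
        C * M.diam * M.l2norm q.toFun := by
  obtain ⟨C, hC, hb⟩ := exists_potOp_bound_on_simplex hd l hρ
  -- One `√C` comes from the potential and one from its gradient.
  refine ⟨2 * Real.sqrt C, by positivity, fun M hM q => ?_⟩
  have hD : 0 ≤ M.diam := Metric.diam_nonneg
  rw [l2norm_brokenPoly, l2norm_brokenVec, l2norm_brokenVec]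
  have h1 := Real.sqrt_le_sqrt (Finset.sum_le_sum fun τ (_ : τ ∈ Finset.univ) => (hb M hM q τ).1)
  have h2 := Real.sqrt_le_sqrt (Finset.sum_le_sum fun τ (_ : τ ∈ Finset.univ) => (hb M hM q τ).2)
  rw [← Finset.mul_sum, Real.sqrt_mul (by positivity), Real.sqrt_mul hC.le,
    Real.sqrt_sq hD] at h1
  rw [← Finset.mul_sum, Real.sqrt_mul hC.le] at h2
  refine (add_le_add h1 (mul_le_mul_of_nonneg_left h2 hD)).trans_eq ?_
  ring

end MeshElement

end HHO

end

/-- Well-posedness, linearity and properties of the scalar potential operator `ϱ^{l+1}`. The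
constant of the bound depends only on `d`, `l` and the mesh regularity parameter `ρ`. -/
theorem mainTheorem3 (d : ℕ) (hd : d = 2 ∨ d = 3) (l : ℕ) :
    (∀ M : HHO.MeshElement d,
      -- the operator is well defined
      (IsUnit (1 - M.projG l * M.projGC l) ∧
        ∀ (q : M.BrokenVec l) (r : M.BrokenPoly (l + 1)),
          M.IsPotential l q r ↔ r = M.potOp l q) ∧
      -- linearity
      IsLinearMap ℝ (M.potOp l) ∧
      -- (i)
      (∀ b ∈ M.goly l, M.grad l (M.potOp l b) = b) ∧
      (∀ c ∈ M.golyC l, M.potOp l c = 0) ∧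
      -- (iii)
      (∀ q : M.BrokenVec l, q - M.grad l (M.potOp l q) ∈ M.golyC l) ∧
      -- (iv)
      (∀ q : HHO.PolyVec d l, ∃ p : HHO.Poly d (l + 1),
        M.potOp l (M.ofPolyVec q) = M.ofPoly p)) ∧
    -- (ii)
    (∀ ρ : ℝ, 0 < ρ → ρ < 1 → ∃ C : ℝ, 0 < C ∧
      ∀ M : HHO.MeshElement d, M.IsRegular ρ → ∀ q : M.BrokenVec l,
        M.l2norm (M.potOp l q).toFun + M.diam * M.l2norm (M.grad l (M.potOp l q)).toFun ≤
          C * M.diam * M.l2norm q.toFun) := by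
  exact ⟨fun M => ⟨⟨M.isUnit_one_sub_projG_mul_projGC hd l, M.isPotential_iff_eq_potOp hd⟩,
    M.isLinearMap_potOp hd l, fun _ hb => M.grad_potOp_of_mem_goly hd hb,
    fun _ hc => M.potOp_of_mem_golyC hd hc, fun q => (M.potOp_spec hd q).1,
    M.exists_potOp_ofPolyVec hd⟩,
    fun _ hρ _ => HHO.MeshElement.exists_potOp_bound hd l hρ⟩
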